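/- **Theorem (Bayesian theorem for persistence diagrams).** Let $\mathbb W=\{(b,p)\in\mathbb R^2: b\ge 0,\ p\ge 0\}$ be the space of (tilted) birth-persistence pairs $(b,p)=(b,d-b)$, $d\ge b\ge 0$, with Lebesgue measure. A finite point process is a random finite multiset of points, and it is Poisson with finite intensity measure $\Lambda$ if its $n$-th Janossy measure is $e^{-\Lambda(\mathbb W)}\Lambda^{\otimes n}$ for every $n\ge 0$. Let $\lambda,\lambda_{Y_S}:\mathbb W\to[0,\infty)$ be measurable with finite integrals, let $\alpha:\mathbb W\to[0,1]$ be measurable, and let $\ell(y|x)\ge 0$ be jointly measurable with $\int_{\mathbb W}\ell(y|x)\,dy=1$ for every $x\in\mathbb W$. Consider the following random diagrams (the homological dimension of the features is fixed). * $\mathcal D_X=\mathcal D_{X_O}\cup\mathcal D_{X_V}$, where $\mathcal D_{X_O}$ (the observed part) and $\mathcal D_{X_V}$ (the vanished part) are Poisson with intensity functions $\alpha\lambda$ and $(1-\alpha)\lambda$. * $\mathcal D_Y=\mathcal D_{Y_O}\cup\mathcal D_{Y_S}$, where $(\mathcal D_{X_O},\mathcal D_{Y_O})$ is a marked Poisson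 process with kernel density $\ell$ (given the points of $\mathcal D_{X_O}$, each point $x$ independently receives one mark with density $\ell(\cdot|x)$, and $\mathcal D_{Y_O}$ consists of the marks), and $\mathcal D_{Y_S}$ (the spurious part) is Poisson with intensity function $\lambda_{Y_S}$. * $(\mathcal D_{X_O},\mathcal D_{Y_O})$, $\mathcal D_{X_V}$ and $\mathcal D_{Y_S}$ are mutually independent. Unions are taken with multiplicity. Let $m\ge 1$, let $(\mathcal D_{X^i},\mathcal D_{Y^i})$, $i=1,\dots,m$, be independent copies of $(\mathcal D_X,\mathcal D_Y)$, together with all their parts, and put $\mathcal G=\sigma(\mathcal D_{Y^1},\dots,\mathcal D_{Y^m})$. Write $$\lambda_Y(y)=\lambda_{Y_S}(y)+\int_{\mathbb W}\ell(y|u)\alpha(u)\lambda(u)\,du .$$ Then almost surely $0<\lambda_Y(y)<\infty$ for every $y\in\mathcal D_{Y^i}$ and every $i$. The posterior intensity of the prior diagram given $\mathcal D_{Y^{1:m}}$, that is, the density of the conditional intensity measure $A\mapsto E\big[\tfrac1m\sum_{i=1}^m\#(\mathcal D_{X^i}\cap A)\,\big|\,\mathcal G\big]$ of the superposition of the $m$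 copies of $\mathcal D_X$ with every point weighted by $1/m$, is $$\lambda_{\mathcal D_X|\mathcal D_{Y^{1:m}}}(x)=(1-\alpha(x))\lambda(x)+\frac{\alpha(x)}{m}\sum_{i=1}^m\sum_{y\in \mathcal D_{Y^i}}\frac{\ell(y|x)\lambda(x)}{\lambda_{Y_S}(y)+\int_{\mathbb W}\ell(y|u)\alpha(u)\lambda(u)\,du}\quad\text{a.s.}$$ More precisely, the right-hand side is almost surely integrable over $\mathbb W$, and for every Borel set $A\subseteq\mathbb W$ its integral over $A$ is almost surely equal to that conditional expectation. Moreover, for each single $i$ the conditional intensity of $\mathcal D_{X^i}$ given $\mathcal G$ has, in the same sense, the density $$(1-\alpha(x))\lambda(x)+\alpha(x)\sum_{y\in \mathcal D_{Y^i}}\frac{\ell(y|x)\lambda(x)}{\lambda_{Y_S}(y)+\int_{\mathbb W}\ell(y|u)\alpha(u)\lambda(u)\,du}.$$ -/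

import Mathlib

open MeasureTheory ProbabilityTheory
open scoped ENNReal NNReal

noncomputable section

/-! ### The space of tilted persistence diagrams of one homological dimension -/

/-- Birth-death pairs `(b, d)` with `d ≥ b ≥ 0`. -/
def birthDeathWedge : Set (ℝ × ℝ) := {q | 0 ≤ q.1 ∧ q.1 ≤ q.2}

/-- The tilt `(b, d) ↦ (b, d - b)`. -/
def tilt (q : ℝ × ℝ) : ℝ × ℝ := (q.1, q.2 - q.1)

/-- The tilted wedge, whose points are birth-persistence pairs. -/
def tiltedWedge : Set (ℝ × ℝ) := tilt '' birthDeathWedge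

theorem mem_tiltedWedge (q : ℝ × ℝ) : q ∈ tiltedWedge ↔ 0 ≤ q.1 ∧ 0 ≤ q.2 := by
  constructor
  · rintro ⟨r, ⟨h1, h2⟩, rfl⟩
    exact ⟨h1, sub_nonneg.2 h2⟩
  · rintro ⟨h1, h2⟩
    refine ⟨(q.1, q.1 + q.2), ⟨h1, by simpa using h2⟩, ?_⟩
    ext <;> simp [tilt]

/-- The tilted wedge as a measurable space (a subspace of the plane). -/
abbrev Wedge : Type := ↥tiltedWedge

/-- Lebesgue measure on the tilted wedge. -/
def wedgeVolume : Measure Wedge := Measure.comap Subtype.val volume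

/-! ### Finite point processes: random finite multisets -/

section PointProcess

variable {Ω X M : Type*} [MeasurableSpace X] [MeasurableSpace M]

open Classical in
/-- The number of points of the finite multiset `D` in the set `A`, with multiplicity. -/
def pointCount (A : Set X) (D : Multiset X) : ℕ := Multiset.card (D.filter (fun x => x ∈ A))

/-- The usual σ-algebra on point configurations: the smallest one for which the number of points
in every measurable set is measurable. -/
instance multisetMeasurableSpace : MeasurableSpace (Multiset X) :=
  ⨆ A : {A : Set X // MeasurableSet A}, MeasurableSpace.comap (pointCount A.1) ⊤

/-- The configuration that consists of the entries of a vector; the order is forgotten. -/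
def configuration {n : ℕ} (x : Fin n → X) : Multiset X := Finset.univ.val.map x

/-- A multiset of points as a purely atomic measure. -/
def toCountingMeasure (D : Multiset X) : Measure X := (D.map Measure.dirac).sum

/-- The law of a Poisson point process with finite intensity measure `Λ`: a finite point process
with `n`-th Janossy measure `exp (-Λ(X)) Λ^{⊗ n}`. Equivalently, the number of points is Poisson
with mean `μ = Λ(X)`, and given that there are `n` points they are independent with law `Λ / μ`. -/
def poissonLaw (Λ : Measure X) : Measure (Multiset X) :=
  Measure.sum fun n : ℕ =>
    ENNReal.ofReal (Real.exp (-(Λ Set.univ).toReal) / (n.factorial : ℝ)) •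
      (Measure.pi fun _ : Fin n => Λ).map configuration

/-- `D` is a (finite) Poisson point process with intensity measure `Λ`. -/
structure IsPoissonProcess [MeasurableSpace Ω] (P : Measure Ω) (Λ : Measure X)
    (D : Ω → Multiset X) : Prop where
  finite_intensity : Λ Set.univ ≠ ∞
  measurable : Measurable D
  law : P.map D = poissonLaw Λ

/-- The law of a marked Poisson point process: the ground points form a Poisson process with
intensity measure `Λ`, and given the ground points `x₁, …, xₙ` the marks are independent, the mark
of `xᵢ` having law `κ(xᵢ, ·)`. The product `δ_{xᵢ} ⊗ κ(xᵢ, ·)` is the law of the pair formed by the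
ground point and its mark. -/
def markedPoissonLaw (Λ : Measure X) (κ : Kernel X M) : Measure (Multiset (X × M)) :=
  Measure.sum fun n : ℕ =>
    ENNReal.ofReal (Real.exp (-(Λ Set.univ).toReal) / (n.factorial : ℝ)) •
      ((Measure.pi fun _ : Fin n => Λ).bind fun x =>
        Measure.pi fun i => (Measure.dirac (x i)).prod (κ (x i))).map configuration

/-- `H` is a marked Poisson point process with ground intensity measure `Λ` and stochastic
kernel `κ`. -/
structure IsMarkedPoissonProcess [MeasurableSpace Ω] (P : Measure Ω) (Λ : Measure X)
    (κ : Kernel X M) (H : Ω → Multiset (X × M)) : Prop where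
  finite_intensity : Λ Set.univ ≠ ∞
  measurable : Measurable H
  law : P.map H = markedPoissonLaw Λ κ

/-- `f ω` is, for almost every `ω`, the density with respect to `ν` of the conditional intensity
measure `A ↦ E[N(A) | 𝒢]` of the random finite measure `N`. For a point process, `N(A)` is the
number of points in `A`. -/
structure IsConditionalIntensity [MeasurableSpace Ω] (P : Measure Ω) (𝒢 : MeasurableSpace Ω)
    (ν : Measure X) (N : Ω → Measure X) (f : Ω → X → ℝ≥0∞) : Prop where
  measurable_density : ∀ ω, Measurable (f ω)
  finite : ∀ᵐ ω ∂P, ∫⁻ x, f ω x ∂ν ≠ ∞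
  integrable : ∀ A : Set X, MeasurableSet A → Integrable (fun ω => (N ω).real A) P
  condExp_eq : ∀ A : Set X, MeasurableSet A →
    P[fun ω => (N ω).real A | 𝒢] =ᵐ[P] fun ω => (∫⁻ x in A, f ω x ∂ν).toReal

/-! ### The model of prior and observed diagrams -/

/-- One realisation of the model. `H` is the marked Poisson process whose ground points are the
observed features `X_O` and whose marks are the associated observations `Y_O`; `V` is the vanished
part `X_V`; `S` is the spurious part `Y_S`. The three are mutually independent. -/
structure IsDiagramModel [MeasurableSpace Ω] (P : Measure Ω) (ν : Measure X)
    (α lam lamS : X → ℝ≥0) (κ : Kernel X X)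
    (H : Ω → Multiset (X × X)) (V S : Ω → Multiset X) : Prop where
  marked : IsMarkedPoissonProcess P (ν.withDensity fun x => (α x : ℝ≥0∞) * lam x) κ H
  vanished : IsPoissonProcess P (ν.withDensity fun x => (1 - (α x : ℝ≥0∞)) * lam x) V
  spurious : IsPoissonProcess P (ν.withDensity fun x => (lamS x : ℝ≥0∞)) S
  indep_marked : IndepFun H (fun ω => (V ω, S ω)) P
  indep_vanished_spurious : IndepFun V S P

/-- The underlying diagram `X = X_O ∪ X_V`. -/
def priorDiagram (H : Multiset (X × X)) (V : Multiset X) : Multiset X := H.map Prod.fst + V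

/-- The observed diagram `Y = Y_O ∪ Y_S`. -/
def observedDiagram (H : Multiset (X × X)) (S : Multiset X) : Multiset X := H.map Prod.snd + S

/-- The σ-algebra generated by the observed diagrams. -/
@[reducible] def observationAlgebra {m : ℕ} (DY : Fin m → Ω → Multiset X) : MeasurableSpace Ω :=
  ⨆ i : Fin m, MeasurableSpace.comap (DY i) multisetMeasurableSpace

/-- The denominator `λ_{Y_S}(y) + ∫ ℓ(y|u) α(u) λ(u) du`; here `ℓ y x` stands for `ℓ(y|x)`. -/
def observedIntensity (ν : Measure X) (α lam lamS : X → ℝ≥0) (ℓ : X → X → ℝ≥0) (y : X) : ℝ≥0∞ :=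
  (lamS y : ℝ≥0∞) + ∫⁻ u, (ℓ y u : ℝ≥0∞) * α u * lam u ∂ν

/-- The posterior intensity at `x` given the diagrams `D 0, …, D (m - 1)`. -/
def posteriorIntensity (ν : Measure X) (α lam lamS : X → ℝ≥0) (ℓ : X → X → ℝ≥0) {m : ℕ}
    (D : Fin m → Multiset X) (x : X) : ℝ≥0∞ :=
  (1 - (α x : ℝ≥0∞)) * lam x +
    (m : ℝ≥0∞)⁻¹ * α x * ∑ i : Fin m, ((D i).map fun y =>
      (ℓ y x : ℝ≥0∞) * lam x / observedIntensity ν α lam lamS ℓ y).sum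

/-- The superposition of `m` diagrams, each point weighted by `1 / m`. -/
def pooledMeasure {m : ℕ} (D : Fin m → Multiset X) : Measure X :=
  (m : ℝ≥0∞)⁻¹ • toCountingMeasure (∑ i : Fin m, D i)

end PointProcess

end

/-! ### Finite configurations: counting, measurability, atomic measures -/

section Configurations

variable {X Y Z : Type*}

/-! The engine is the Mecke formula: for a Poisson process D with intensity Λ, E[∑_{x ∈ D} h(x) ·
g(D)] = ∫ h(a) E[g(D + δ_a)] Λ(da) (`lintegral_poissonLaw_sum_mul`). It persists when g also depends
on an independent random element. It applies to the marked process because H is itself Poisson on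
the space of pairs, with intensity (αλ) ⊗ κ (`markedPoissonLaw_eq_poissonLaw`).

Fix one copy and let g ≥ 0 be a function of its observed diagram Y. Inserting a pair (x, y) into H
and inserting y into S have the same effect on Y: it becomes Y + δ_y. With q(y) = E[g(Y + δ_y)] the
Mecke formula therefore gives E[#(X_O ∩ A) g(Y)] = ∫ (∫_A ℓ(y|x) α(x) λ(x) dx) q(y) dy and E[∑_{y ∈
Y} h(y) · g(Y)] = ∫ λ_Y(y) h(y) q(y) dy. The two agree when h is the quotient of ∫_A ℓ(y|x) α(x)
λ(x) dx by λ_Y(y), which is the integral over A of the summand in the theorem. The vanished part is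
independent of Y and contributes its mean, the integral of (1 - α)λ. This is
`IsDiagramModel.lintegral_prior_mul`; no conditional law of the prior diagram is ever constructed.

To condition on all m observations, use independence of the copies: on a rectangle ⋂ {Y^j ∈ B_j} the
factors with j ≠ i split off, and the rectangles are a π-system generating 𝒢
(`setLIntegral_eq_of_iIndepFun`). Equality of integrals over all events of 𝒢 characterises the
conditional expectation, and averaging over i gives the pooled formula. -/

theorem pointCount_zero (A : Set X) : pointCount A (0 : Multiset X) = 0 := by
  simp [pointCount]

theorem pointCount_add (A : Set X) (D E : Multiset X) :
    pointCount A (D + E) = pointCount A D + pointCount A E := by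
  simp [pointCount]

open Classical in
theorem pointCount_cons (A : Set X) (x : X) (D : Multiset X) :
    pointCount A (x ::ₘ D) = (if x ∈ A then 1 else 0) + pointCount A D := by
  by_cases h : x ∈ A <;> simp [pointCount, h, add_comm]

theorem pointCount_map (A : Set Y) (f : X → Y) (D : Multiset X) :
    pointCount A (D.map f) = pointCount (f ⁻¹' A) D := by
  simp only [pointCount, Multiset.filter_map, Multiset.card_map]
  rfl

theorem coe_pointCount (A : Set X) (D : Multiset X) :
    (pointCount A D : ℝ≥0∞) = (D.map (A.indicator 1)).sum := by
  classical
  induction D using Multiset.induction_on with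
  | empty => simp [pointCount_zero]
  | cons x D ih => by_cases h : x ∈ A <;> simp [pointCount_cons, ih, h]

theorem configuration_insertNth {n : ℕ} (i : Fin (n + 1)) (a : X) (x : Fin n → X) :
    configuration (i.insertNth a x : Fin (n + 1) → X) = a ::ₘ configuration x := by
  simp only [configuration, Fin.univ_succAbove n i]
  simp [Function.comp_def]

variable [MeasurableSpace X] [MeasurableSpace Y] [MeasurableSpace Z]

theorem measurable_pointCount {A : Set X} (hA : MeasurableSet A) :
    Measurable (pointCount A : Multiset X → ℕ) :=
  (comap_measurable _).mono
    (le_iSup (fun A : {A : Set X // MeasurableSet A} =>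
      MeasurableSpace.comap (pointCount A.1) ⊤) ⟨A, hA⟩) le_rfl

theorem measurable_multiset_of_pointCount {f : Z → Multiset X}
    (h : ∀ A : Set X, MeasurableSet A → Measurable fun z => pointCount A (f z)) :
    Measurable f := by
  rw [measurable_iff_comap_le, multisetMeasurableSpace, MeasurableSpace.comap_iSup]
  refine iSup_le fun A => ?_
  rw [MeasurableSpace.comap_comp]
  exact (h A.1 A.2).comap_le

theorem Measurable.multiset_add {f g : Z → Multiset X} (hf : Measurable f) (hg : Measurable g) :
    Measurable fun z => f z + g z := by
  refine measurable_multiset_of_pointCount fun A hA => ?_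
  simp only [pointCount_add]
  exact ((measurable_pointCount hA).comp hf).add ((measurable_pointCount hA).comp hg)

theorem Measurable.multiset_cons {f : Z → X} {g : Z → Multiset X} (hf : Measurable f)
    (hg : Measurable g) : Measurable fun z => f z ::ₘ g z := by
  classical
  refine measurable_multiset_of_pointCount fun A hA => ?_
  simp only [pointCount_cons]
  exact (Measurable.ite (hf hA) measurable_const measurable_const).add
    ((measurable_pointCount hA).comp hg)

theorem Measurable.multiset_map {f : X → Y} {g : Z → Multiset X} (hf : Measurable f)
    (hg : Measurable g) : Measurable fun z => (g z).map f := by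
  refine measurable_multiset_of_pointCount fun A hA => ?_
  simp only [pointCount_map]
  exact (measurable_pointCount (hf hA)).comp hg

theorem measurable_configuration {n : ℕ} :
    Measurable (configuration : (Fin n → X) → Multiset X) := by
  induction n with
  | zero => exact measurable_of_finite _
  | succ n ih =>
    have : (configuration : (Fin (n + 1) → X) → Multiset X) =
        fun x => x 0 ::ₘ configuration (fun j => x (Fin.succ j)) := by
      ext1 x
      rw [← configuration_insertNth 0]
      congr
      exact ((Fin.insertNth_zero' (x 0) fun j => x (Fin.succ j)).trans (Fin.cons_self_tail x)).symm
    rw [this]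
    exact (measurable_pi_apply 0).multiset_cons
      (ih.comp (measurable_pi_lambda _ fun j => measurable_pi_apply _))

theorem toCountingMeasure_zero : toCountingMeasure (0 : Multiset X) = 0 := by
  simp [toCountingMeasure]

theorem toCountingMeasure_cons (x : X) (D : Multiset X) :
    toCountingMeasure (x ::ₘ D) = Measure.dirac x + toCountingMeasure D := by
  simp [toCountingMeasure]

theorem toCountingMeasure_add (D E : Multiset X) :
    toCountingMeasure (D + E) = toCountingMeasure D + toCountingMeasure E := by
  simp [toCountingMeasure]

theorem toCountingMeasure_sum {ι : Type*} (s : Finset ι) (D : ι → Multiset X) :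
    toCountingMeasure (∑ i ∈ s, D i) = ∑ i ∈ s, toCountingMeasure (D i) := by
  classical
  induction s using Finset.induction_on with
  | empty => simp [toCountingMeasure_zero]
  | insert i s hi ih => simp [Finset.sum_insert hi, toCountingMeasure_add, ih]

theorem lintegral_toCountingMeasure {h : X → ℝ≥0∞} (hh : Measurable h) (D : Multiset X) :
    ∫⁻ x, h x ∂toCountingMeasure D = (D.map h).sum := by
  induction D using Multiset.induction_on with
  | empty => simp [toCountingMeasure_zero]
  | cons x D ih => simp [toCountingMeasure_cons, lintegral_add_measure, lintegral_dirac' _ hh, ih]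

theorem toCountingMeasure_apply {A : Set X} (hA : MeasurableSet A) (D : Multiset X) :
    toCountingMeasure D A = (D.map (A.indicator 1)).sum := by
  rw [← lintegral_toCountingMeasure (measurable_one.indicator hA), lintegral_indicator_one hA]

/-- Makes sums over a configuration measurable: such a sum is an integral against the counting
measure, and integration is measurable in the measure. -/
theorem measurable_toCountingMeasure :
    Measurable (toCountingMeasure : Multiset X → Measure X) := by
  refine Measure.measurable_of_measurable_coe _ fun A hA => ?_
  simp only [toCountingMeasure_apply hA, ← coe_pointCount]
  exact measurable_from_top.comp (measurable_pointCount hA)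

theorem measurable_multiset_sum_map {h : X → ℝ≥0∞} (hh : Measurable h) :
    Measurable fun D : Multiset X => (D.map h).sum := by
  simp only [← lintegral_toCountingMeasure hh]
  exact (Measure.measurable_lintegral hh).comp measurable_toCountingMeasure

end Configurations

/-! ### Poisson laws, marking and the Mecke formula -/

section PoissonLaw

variable {X Y T Ω : Type*} [MeasurableSpace X] [MeasurableSpace Y] [MeasurableSpace T]
  [MeasurableSpace Ω]

theorem lintegral_pi_fin_prod (Λ : Measure X) [SigmaFinite Λ] {n : ℕ} {f : Fin n → X → ℝ≥0∞}
    (hf : ∀ i, Measurable (f i)) :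
    ∫⁻ x, ∏ i, f i (x i) ∂(Measure.pi fun _ : Fin n => Λ) = ∏ i, ∫⁻ a, f i a ∂Λ := by
  induction n with
  | zero => simp
  | succ n ih =>
    rw [← (measurePreserving_piFinSuccAbove (fun _ : Fin (n + 1) => Λ) 0).symm.lintegral_comp_emb
      (MeasurableEquiv.measurableEmbedding _)]
    simp only [Fin.prod_univ_succ]
    have := lintegral_prod_mul (μ := Λ) (ν := Measure.pi fun _ : Fin n => Λ)
      (f := f 0) (g := fun x => ∏ i : Fin n, f i.succ (x i)) (hf 0).aemeasurable
      (Finset.measurable_prod _ fun i _ => (hf _).comp (measurable_pi_apply i)).aemeasurable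
    rw [ih fun i => hf i.succ] at this
    rw [← this]
    rfl

/-- On a box the inner product measure factorises over the coordinates, and Tonelli then factorises
the outer integral; boxes determine a finite product measure. -/
theorem pi_compProd (Λ : Measure X) [IsFiniteMeasure Λ] (κ : Kernel X Y) [IsMarkovKernel κ] (n : ℕ) :
    ((Measure.pi fun _ : Fin n => Λ).bind fun x =>
        Measure.pi fun i => (Measure.dirac (x i)).prod (κ (x i))) =
      Measure.pi fun _ : Fin n => Λ ⊗ₘ κ := by
  have hbox : ∀ B : Set (X × Y), MeasurableSet B →
      ∀ x, ((Measure.dirac x).prod (κ x)) B = κ x (Prod.mk x ⁻¹' B) := by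
    intro B hB x
    rw [Measure.dirac_prod, Measure.map_apply measurable_prodMk_left hB]
  have hm : Measurable fun x : Fin n → X =>
      Measure.pi fun i => (Measure.dirac (x i)).prod (κ (x i)) := by
    refine Measurable.measure_of_isPiSystem_of_isProbabilityMeasure generateFrom_pi.symm
      isPiSystem_pi ?_
    rintro _ ⟨s, hs, rfl⟩
    simp only [Set.mem_pi, Set.mem_univ, Set.mem_ofPred_eq, forall_const] at hs
    simp only [Measure.pi_pi, hbox _ (hs _)]
    exact Finset.measurable_prod _ fun i _ =>
      (Kernel.measurable_kernel_prodMk_left (hs i)).comp (measurable_pi_apply i)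
  symm
  refine Measure.pi_eq fun s hs => ?_
  rw [Measure.bind_apply (MeasurableSet.univ_pi hs) hm.aemeasurable]
  simp only [Measure.pi_pi, hbox _ (hs _), Measure.compProd_apply (hs _)]
  exact lintegral_pi_fin_prod Λ fun i => Kernel.measurable_kernel_prodMk_left (hs i)

theorem markedPoissonLaw_eq_poissonLaw (Λ : Measure X) [IsFiniteMeasure Λ] (κ : Kernel X Y)
    [IsMarkovKernel κ] : markedPoissonLaw Λ κ = poissonLaw (Λ ⊗ₘ κ) := by
  simp only [markedPoissonLaw, poissonLaw, pi_compProd, Measure.compProd_apply_univ]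

theorem lintegral_poissonLaw (Λ : Measure X) {F : Multiset X → ℝ≥0∞} (hF : Measurable F) :
    ∫⁻ D, F D ∂poissonLaw Λ = ∑' n : ℕ,
      ENNReal.ofReal (Real.exp (-(Λ Set.univ).toReal) / (n.factorial : ℝ)) *
        ∫⁻ x, F (configuration x) ∂(Measure.pi fun _ : Fin n => Λ) := by
  simp only [poissonLaw, lintegral_sum_measure, lintegral_smul_measure, smul_eq_mul,
    lintegral_map hF measurable_configuration]

/-- A configuration forgets the order, so each of the n + 1 coordinates contributes the same
integral. Splitting off coordinate i by Tonelli turns the configuration into the point a added to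
the remaining n. -/
theorem lintegral_pi_sum_mul_configuration (Λ : Measure X) [SigmaFinite Λ] (n : ℕ)
    {h : X → ℝ≥0∞} (hh : Measurable h) {g : Multiset X → ℝ≥0∞} (hg : Measurable g) :
    ∫⁻ x, ((configuration x).map h).sum * g (configuration x)
        ∂(Measure.pi fun _ : Fin (n + 1) => Λ) =
      (n + 1 : ℝ≥0∞) * ∫⁻ a, h a *
        ∫⁻ x, g (a ::ₘ configuration x) ∂(Measure.pi fun _ : Fin n => Λ) ∂Λ := by
  have hgm : ∀ k, Measurable fun x : Fin k → X => g (configuration x) := fun k =>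
    hg.comp measurable_configuration
  have hconf : ∀ x : Fin (n + 1) → X, ((configuration x).map h).sum = ∑ i, h (x i) := by
    intro x
    simp only [configuration, Multiset.map_map]
    rfl
  simp only [hconf, Finset.sum_mul]
  have hm : ∀ i : Fin (n + 1),
      Measurable fun x : Fin (n + 1) → X => h (x i) * g (configuration x) :=
    fun i => (hh.comp (measurable_pi_apply i)).mul (hgm _)
  rw [lintegral_finsetSum _ fun i _ => hm i]
  have key : ∀ i : Fin (n + 1),
      ∫⁻ x, h (x i) * g (configuration x) ∂(Measure.pi fun _ : Fin (n + 1) => Λ) =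
      ∫⁻ a, h a * ∫⁻ x, g (a ::ₘ configuration x) ∂(Measure.pi fun _ : Fin n => Λ) ∂Λ := by
    intro i
    have hcons : Measurable fun z : X × (Fin n → X) => g (z.1 ::ₘ configuration z.2) :=
      hg.comp (measurable_fst.multiset_cons (measurable_configuration.comp measurable_snd))
    rw [← (measurePreserving_piFinSuccAbove (fun _ : Fin (n + 1) => Λ) i).symm.lintegral_comp_emb
      (MeasurableEquiv.measurableEmbedding _)]
    calc _ = ∫⁻ z, h z.1 * g (z.1 ::ₘ configuration z.2)
            ∂(Λ.prod (Measure.pi fun _ : Fin n => Λ)) := by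
          refine lintegral_congr fun z => ?_
          rw [← configuration_insertNth i]
          have hi : (i.insertNth z.1 z.2 : Fin (n + 1) → X) i = z.1 := Fin.insertNth_apply_same ..
          exact congrArg
            (fun t => h t * g (configuration (i.insertNth z.1 z.2 : Fin (n + 1) → X))) hi
      _ = _ := by
          have hm : Measurable fun z : X × (Fin n → X) => h z.1 * g (z.1 ::ₘ configuration z.2) :=
            (hh.comp measurable_fst).mul hcons
          rw [lintegral_prod _ hm.aemeasurable]
          refine lintegral_congr fun a => ?_
          exact lintegral_const_mul (h a) (f := fun x => g (a ::ₘ configuration x))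
            (hcons.comp measurable_prodMk_left)
  simp [key]

/-- The Mecke formula, read off the Janossy expansion: choosing the marked point among n + 1 gives a
factor n + 1, which reduces the weight 1/(n + 1)! to 1/n!. -/
theorem lintegral_poissonLaw_sum_mul (Λ : Measure X) [SigmaFinite Λ]
    {h : X → ℝ≥0∞} (hh : Measurable h) {g : Multiset X → ℝ≥0∞} (hg : Measurable g) :
    ∫⁻ D, (D.map h).sum * g D ∂poissonLaw Λ =
      ∫⁻ a, h a * ∫⁻ D, g (a ::ₘ D) ∂poissonLaw Λ ∂Λ := by
  have hcons : ∀ n, Measurable fun z : X × (Fin n → X) => g (z.1 ::ₘ configuration z.2) :=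
    fun n => hg.comp (measurable_fst.multiset_cons (measurable_configuration.comp measurable_snd))
  have hin : ∀ n, Measurable fun a : X =>
      ∫⁻ x, g (a ::ₘ configuration x) ∂(Measure.pi fun _ : Fin n => Λ) :=
    fun n => (hcons n).lintegral_prod_right'
  have hm : Measurable fun D : Multiset X => (D.map h).sum * g D :=
    (measurable_multiset_sum_map hh).mul hg
  rw [lintegral_poissonLaw _ hm,
    tsum_eq_zero_add' ENNReal.summable]
  -- The term n = 0 vanishes because the sum over the empty configuration is zero; the shifted
  -- series remains.
  have h0 : ∀ x : Fin 0 → X, ((configuration x).map h).sum = 0 := fun x => by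
    simp [configuration]
  simp only [h0, zero_mul, lintegral_zero, mul_zero, zero_add,
    lintegral_pi_sum_mul_configuration Λ _ hh hg]
  have hsucc : ∀ a, Measurable fun D : Multiset X => g (a ::ₘ D) := fun a =>
    hg.comp (measurable_const.multiset_cons measurable_id)
  simp_rw [fun a => lintegral_poissonLaw Λ (hsucc a), ← ENNReal.tsum_mul_left]
  have hhin : ∀ n, Measurable fun a : X =>
      h a * ∫⁻ x, g (a ::ₘ configuration x) ∂(Measure.pi fun _ : Fin n => Λ) :=
    fun n => hh.mul (hin n)
  simp_rw [mul_left_comm (h _)]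
  rw [lintegral_tsum fun n => ((hhin n).const_mul _).aemeasurable]
  refine tsum_congr fun n => ?_
  rw [lintegral_const_mul _ (hhin n), ← mul_assoc]
  congr 1
  have : (n + 1 : ℝ≥0∞) = ENNReal.ofReal (n + 1 : ℝ) := by
    rw [ENNReal.ofReal_add (by positivity) zero_le_one]; simp
  rw [this, ← ENNReal.ofReal_mul (by positivity)]
  congr 1
  rw [Nat.factorial_succ]
  push_cast
  field_simp

theorem IsMarkedPoissonProcess.isPoissonProcess {P : Measure Ω} {Λ : Measure X} {κ : Kernel X Y}
    [IsMarkovKernel κ] {H : Ω → Multiset (X × Y)} (hH : IsMarkedPoissonProcess P Λ κ H) :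
    IsPoissonProcess P (Λ ⊗ₘ κ) H := by
  have : IsFiniteMeasure Λ := ⟨hH.finite_intensity.lt_top⟩
  exact ⟨measure_ne_top _ _, hH.measurable, hH.law.trans (markedPoissonLaw_eq_poissonLaw Λ κ)⟩

/-- The Mecke formula for a Poisson process in the presence of an independent random element. -/
theorem IsPoissonProcess.lintegral_sum_mul {P : Measure Ω} [IsProbabilityMeasure P] {Λ : Measure X}
    {D : Ω → Multiset X} (hD : IsPoissonProcess P Λ D) {W : Ω → T} (hW : Measurable W)
    (hind : IndepFun D W P) {h : X → ℝ≥0∞} (hh : Measurable h) {g : Multiset X × T → ℝ≥0∞}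
    (hg : Measurable g) :
    ∫⁻ ω, ((D ω).map h).sum * g (D ω, W ω) ∂P =
      ∫⁻ a, h a * ∫⁻ ω, g (a ::ₘ D ω, W ω) ∂P ∂Λ := by
  have : IsFiniteMeasure Λ := ⟨hD.finite_intensity.lt_top⟩
  -- Total mass one is inherited from the law of D, so the exponential series need not be summed.
  have : IsProbabilityMeasure (poissonLaw Λ) :=
    hD.law ▸ Measure.isProbabilityMeasure_map hD.measurable.aemeasurable
  have : IsProbabilityMeasure (P.map W) := Measure.isProbabilityMeasure_map hW.aemeasurable
  have hmap : P.map (fun ω => (D ω, W ω)) = (poissonLaw Λ).prod (P.map W) := by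
    rw [← hD.law]
    exact (indepFun_iff_map_prod_eq_prod_map_map hD.measurable.aemeasurable hW.aemeasurable).1 hind
  -- With W integrated last, the Mecke formula can be applied for each fixed value w.
  have htrans : ∀ F : Multiset X × T → ℝ≥0∞, Measurable F →
      ∫⁻ ω, F (D ω, W ω) ∂P = ∫⁻ w, ∫⁻ E, F (E, w) ∂poissonLaw Λ ∂P.map W := by
    intro F hF
    rw [← lintegral_prod_symm' _ hF, ← hmap, lintegral_map hF (hD.measurable.prodMk hW)]
  have hsum := measurable_multiset_sum_map hh
  rw [htrans (fun z => (z.1.map h).sum * g z) ((hsum.comp measurable_fst).mul hg)]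
  have hcons : Measurable fun z : (X × T) × Multiset X => g (z.1.1 ::ₘ z.2, z.1.2) :=
    hg.comp (((measurable_fst.comp measurable_fst).multiset_cons measurable_snd).prodMk
      (measurable_snd.comp measurable_fst))
  have hcons' : Measurable fun z : X × T => ∫⁻ E, g (z.1 ::ₘ E, z.2) ∂poissonLaw Λ :=
    hcons.lintegral_prod_right'
  calc _ = ∫⁻ w, ∫⁻ a, h a * ∫⁻ E, g (a ::ₘ E, w) ∂poissonLaw Λ ∂Λ ∂P.map W :=
        lintegral_congr fun w =>
          lintegral_poissonLaw_sum_mul Λ hh (hg.comp measurable_prodMk_right)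
    _ = ∫⁻ a, ∫⁻ w, h a * ∫⁻ E, g (a ::ₘ E, w) ∂poissonLaw Λ ∂P.map W ∂Λ :=
        lintegral_lintegral_swap
          (((hh.comp measurable_snd).mul (hcons'.comp measurable_swap)).aemeasurable)
    _ = _ := by
        refine lintegral_congr fun a => ?_
        have hm : Measurable fun w => ∫⁻ E, g (a ::ₘ E, w) ∂poissonLaw Λ :=
          hcons'.comp measurable_prodMk_left
        rw [lintegral_const_mul _ hm, htrans (fun z => g (a ::ₘ z.1, z.2))
            (hg.comp ((measurable_const.multiset_cons measurable_fst).prodMk measurable_snd))]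

end PoissonLaw

/-! ### Conditional intensities and independent copies -/

section ConditionalIntensity

variable {Ω X : Type*} [MeasurableSpace X] {𝒢 mΩ : MeasurableSpace Ω}

/-- Reduces the problem to identities between `ℝ≥0∞`-valued integrals. The only finiteness required
is that of the mean total mass of N. -/
theorem isConditionalIntensity_of_setLIntegral_eq {P : Measure Ω} [IsProbabilityMeasure P]
    (h𝒢 : 𝒢 ≤ mΩ) {ν : Measure X} {N : Ω → Measure X}
    {f : Ω → X → ℝ≥0∞} (hf : ∀ ω, Measurable (f ω))
    (hN : ∀ A, MeasurableSet A → Measurable fun ω => N ω A)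
    (hfm : ∀ A, MeasurableSet A → Measurable[𝒢] fun ω => ∫⁻ x in A, f ω x ∂ν)
    (hfin : ∫⁻ ω, N ω Set.univ ∂P ≠ ∞)
    (heq : ∀ A, MeasurableSet A → ∀ B, MeasurableSet[𝒢] B →
      ∫⁻ ω in B, N ω A ∂P = ∫⁻ ω in B, ∫⁻ x in A, f ω x ∂ν ∂P) :
    IsConditionalIntensity P 𝒢 ν N f := by
  have hNfin : ∀ A, ∫⁻ ω, N ω A ∂P ≠ ∞ := fun A =>
    ne_top_of_le_ne_top hfin (lintegral_mono fun ω => measure_mono (Set.subset_univ A))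
  have hfA : ∀ A, MeasurableSet A → ∫⁻ ω, ∫⁻ x in A, f ω x ∂ν ∂P ≠ ∞ := by
    intro A hA
    -- Taking B to be the whole space transfers finiteness from N to the candidate density.
    have := heq A hA Set.univ MeasurableSet.univ
    simp only [Measure.restrict_univ] at this
    exact this ▸ hNfin A
  have hfm' : ∀ A, MeasurableSet A → Measurable fun ω => ∫⁻ x in A, f ω x ∂ν :=
    fun A hA => (hfm A hA).mono h𝒢 le_rfl
  have hint : ∀ A, MeasurableSet A → Integrable (fun ω => (N ω).real A) P := fun A hA =>
    integrable_toReal_of_lintegral_ne_top (hN A hA).aemeasurable (hNfin A)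
  refine ⟨hf, ?_, hint, fun A hA => ?_⟩
  · have hm := hfm' Set.univ MeasurableSet.univ
    have := hfA Set.univ MeasurableSet.univ
    simp only [Measure.restrict_univ] at hm this
    exact (ae_lt_top hm this).mono fun ω h => h.ne
  · have hintf := integrable_toReal_of_lintegral_ne_top (hfm' A hA).aemeasurable (hfA A hA)
    refine (ae_eq_condExp_of_forall_setIntegral_eq h𝒢 (hint A hA)
      (fun B _ _ => hintf.integrableOn) (fun B hB _ => ?_)
      (hfm A hA).ennreal_toReal.stronglyMeasurable.aestronglyMeasurable).symm
    simp only [Measure.real]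
    rw [integral_toReal (hfm' A hA).aemeasurable
        (ae_restrict_of_ae (ae_lt_top (hfm' A hA) (hfA A hA))),
      integral_toReal (hN A hA).aemeasurable
        (ae_restrict_of_ae (ae_lt_top (hN A hA) (hNfin A))), heq A hA B hB]

/-- If two functions of the `i`-th element of an independent family have the same integral over
every event determined by `Y i`, then they do so over every event determined by all `Y j`. -/
theorem setLIntegral_eq_of_iIndepFun {ι Z T : Type*} [Fintype ι] [MeasurableSpace Z]
    [MeasurableSpace T] {P : Measure Ω} [IsProbabilityMeasure P] {W : ι → Ω → Z}
    (hW : ∀ i, Measurable (W i)) (hind : iIndepFun W P) {y : Z → T} (hy : Measurable y) (i : ι)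
    {φ ψ : Z → ℝ≥0∞} (hφ : Measurable φ) (hψ : Measurable ψ)
    (hfin : ∫⁻ ω, φ (W i ω) ∂P ≠ ∞)
    (heq : ∀ B, MeasurableSet B → ∫⁻ ω, φ (W i ω) * B.indicator 1 (y (W i ω)) ∂P =
      ∫⁻ ω, ψ (W i ω) * B.indicator 1 (y (W i ω)) ∂P)
    (h𝒢def : 𝒢 = ⨆ j, MeasurableSpace.comap (fun ω => y (W j ω)) inferInstance)
    {C : Set Ω} (hC : MeasurableSet[𝒢] C) :
    ∫⁻ ω in C, φ (W i ω) ∂P = ∫⁻ ω in C, ψ (W i ω) ∂P := by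
  classical
  have h𝒢 : 𝒢 ≤ mΩ := h𝒢def ▸ iSup_le fun j => (hy.comp (hW j)).comap_le
  have hprod : ∀ θ : Z → ℝ≥0∞, Measurable θ → ∀ B : ι → Set T, (∀ j, MeasurableSet (B j)) →
      ∫⁻ ω in ⋂ j, (fun ω => y (W j ω)) ⁻¹' B j, θ (W i ω) ∂P =
        (∫⁻ ω, θ (W i ω) * (B i).indicator 1 (y (W i ω)) ∂P) *
          ∏ j ∈ Finset.univ.erase i, ∫⁻ ω, (B j).indicator 1 (y (W j ω)) ∂P := by
    intro θ hθ B hB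
    -- The product of the G j is θ at index i times the indicator of the rectangle, so independence
    -- factorises the integral.
    let G : ι → Z → ℝ≥0∞ := fun j z =>
      (if j = i then θ z else 1) * (B j).indicator 1 (y z)
    have hG : ∀ j, Measurable (G j) := by
      intro j
      refine Measurable.mul ?_ ((measurable_one.indicator (hB j)).comp hy)
      split_ifs
      exacts [hθ, measurable_const]
    have := lintegral_prod_eq_prod_lintegral_of_indepFun Finset.univ
      (fun j ω => G j (W j ω)) (hind.comp G hG) fun j => (hG j).comp (hW j)
    rw [← Finset.mul_prod_erase _ _ (Finset.mem_univ i)] at this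
    have hset : MeasurableSet (⋂ j, (fun ω => y (W j ω)) ⁻¹' B j) :=
      MeasurableSet.iInter fun j => (hy.comp (hW j)) (hB j)
    rw [← lintegral_indicator hset]
    refine Eq.trans (lintegral_congr fun ω => ?_) (this.trans ?_)
    · simp only [G, Finset.prod_mul_distrib, Finset.prod_ite_eq', Finset.mem_univ, if_true]
      by_cases hω : ∀ j, y (W j ω) ∈ B j
      · rw [Set.indicator_of_mem (by simpa using hω)]
        simp [hω]
      · rw [Set.indicator_of_notMem (by simpa using hω)]
        push Not at hω
        obtain ⟨j, hj⟩ := hω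
        rw [Finset.prod_eq_zero (Finset.mem_univ j) (by simp [hj]), mul_zero]
    · simp only [G, if_true]
      congr 1
      refine Finset.prod_congr rfl fun j hj => ?_
      simp [Finset.ne_of_mem_erase hj]
  have hbox : ∀ B : ι → Set T, (∀ j, MeasurableSet (B j)) →
      ∫⁻ ω in ⋂ j, (fun ω => y (W j ω)) ⁻¹' B j, φ (W i ω) ∂P =
        ∫⁻ ω in ⋂ j, (fun ω => y (W j ω)) ⁻¹' B j, ψ (W i ω) ∂P := by
    intro B hB
    rw [hprod φ hφ B hB, hprod ψ hψ B hB, heq _ (hB i)]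
  let μ : Measure Ω := P.withDensity fun ω => φ (W i ω)
  let μ' : Measure Ω := P.withDensity fun ω => ψ (W i ω)
  -- Agreement on a π-system extends to the generated σ-algebra for finite measures of equal total
  -- mass. Trimming to 𝒢 is needed because the rectangles generate only 𝒢.
  have : IsFiniteMeasure (μ.trim h𝒢) := by
    have : IsFiniteMeasure μ := isFiniteMeasure_withDensity hfin
    exact isFiniteMeasure_trim h𝒢
  have htrim : μ.trim h𝒢 = μ'.trim h𝒢 := by
    have huniv : μ.trim h𝒢 Set.univ = μ'.trim h𝒢 Set.univ := by
      have := hbox (fun _ => Set.univ) fun _ => MeasurableSet.univ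
      simp only [Set.preimage_univ, Set.iInter_univ, Measure.restrict_univ] at this
      rw [trim_measurableSet_eq h𝒢 MeasurableSet.univ, trim_measurableSet_eq h𝒢 MeasurableSet.univ]
      simp [μ, μ', withDensity_apply, this]
    let mY : ι → MeasurableSpace Ω := fun j =>
      MeasurableSpace.comap (fun ω => y (W j ω)) inferInstance
    have hgen : 𝒢 = MeasurableSpace.generateFrom
        (piiUnionInter (fun j => {s | MeasurableSet[mY j] s}) Set.univ) := by
      rw [generateFrom_piiUnionInter_measurableSet mY Set.univ]
      simp [h𝒢def, mY]
    refine @ext_of_generate_finite Ω 𝒢 _ _ _ hgen ?_ _ ?_ huniv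
    · exact isPiSystem_piiUnionInter _
        (fun j => @MeasurableSpace.isPiSystem_measurableSet _ (_)) _
    · intro s hs
      have hs𝒢 : MeasurableSet[𝒢] s := by
        rw [hgen]
        exact MeasurableSpace.measurableSet_generateFrom hs
      rw [trim_measurableSet_eq h𝒢 hs𝒢, trim_measurableSet_eq h𝒢 hs𝒢,
        withDensity_apply _ (h𝒢 _ hs𝒢), withDensity_apply _ (h𝒢 _ hs𝒢)]
      obtain ⟨t, -, f, hf, rfl⟩ := hs
      choose! B hB hBf using hf
      -- The π-system constrains only finitely many indices; the others receive the trivial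
      -- constraint `Set.univ`.
      have : ⋂ x ∈ t, f x =
          ⋂ j, (fun ω => y (W j ω)) ⁻¹' (if j ∈ t then B j else Set.univ) := by
        refine Set.iInter_congr fun j => ?_
        by_cases hj : j ∈ t
        · simp [hj, ← hBf j hj]
        · simp [hj]
      rw [this]
      refine hbox _ fun j => ?_
      split_ifs with hj
      exacts [hB j hj, MeasurableSet.univ]
  have := congrArg (fun ρ => @DFunLike.coe (@Measure Ω 𝒢) _ _ _ ρ C) htrim
  simpa only [trim_measurableSet_eq h𝒢 hC, μ, μ', withDensity_apply _ (h𝒢 _ hC)] using this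

end ConditionalIntensity

/-! ### One realisation of the model: Mecke identities and the posterior -/

section DiagramModel

variable {Ω X Y : Type*}

/-- With its counterpart for S, this is why observed and spurious points are indistinguishable in Y:
only the mark of an added pair is seen. -/
theorem observedDiagram_cons_left (z : X × X) (H : Multiset (X × X)) (S : Multiset X) :
    observedDiagram (z ::ₘ H) S = z.2 ::ₘ observedDiagram H S := by
  simp [observedDiagram]

theorem observedDiagram_cons_right (y : X) (H : Multiset (X × X)) (S : Multiset X) :
    observedDiagram H (y ::ₘ S) = y ::ₘ observedDiagram H S := by
  simp [observedDiagram]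

theorem multiset_sum_map_mul_left (D : Multiset Y) (c : ℝ≥0∞) (h : Y → ℝ≥0∞) :
    c * (D.map h).sum = (D.map fun y => c * h y).sum :=
  Multiset.sum_map_mul_left.symm

variable [MeasurableSpace Ω] [MeasurableSpace X]

theorem lintegral_multiset_sum_map (ν : Measure X) (D : Multiset Y) {F : Y → X → ℝ≥0∞}
    (hF : ∀ y, Measurable (F y)) :
    ∫⁻ x, (D.map fun y => F y x).sum ∂ν = (D.map fun y => ∫⁻ x, F y x ∂ν).sum := by
  induction D using Multiset.induction_on with
  | empty => simp
  | cons y D ih => simp [lintegral_add_left (hF y), ih]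

theorem measurable_observedDiagram :
    Measurable fun z : Multiset (X × X) × Multiset X => observedDiagram z.1 z.2 :=
  (measurable_snd.multiset_map measurable_fst).multiset_add measurable_snd

theorem measurable_priorDiagram :
    Measurable fun z : Multiset (X × X) × Multiset X => priorDiagram z.1 z.2 :=
  (measurable_fst.multiset_map measurable_fst).multiset_add measurable_snd

/-- The expected number of points of `A` that are observed, per unit of observed intensity
at `y`. -/
noncomputable def observedShare (ν : Measure X) (α lam lamS : X → ℝ≥0) (ℓ : X → X → ℝ≥0)
    (A : Set X) (y : X) : ℝ≥0∞ :=
  (∫⁻ x in A, (ℓ y x : ℝ≥0∞) * α x * lam x ∂ν) / observedIntensity ν α lam lamS ℓ y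

variable {P : Measure Ω} {ν : Measure X} {α lam lamS : X → ℝ≥0} {κ : Kernel X X} {ℓ : X → X → ℝ≥0}
  {H : Ω → Multiset (X × X)} {V S : Ω → Multiset X}

theorem measurable_observationDensity (hα : Measurable α) (hlam : Measurable lam)
    (hℓ : Measurable (Function.uncurry ℓ)) :
    Measurable fun z : X × X => (ℓ z.1 z.2 : ℝ≥0∞) * α z.2 * lam z.2 :=
  (hℓ.coe_nnreal_ennreal.mul (hα.comp measurable_snd).coe_nnreal_ennreal).mul
    (hlam.comp measurable_snd).coe_nnreal_ennreal

theorem measurable_observationDensity_left (hα : Measurable α) (hlam : Measurable lam)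
    (hℓ : Measurable (Function.uncurry ℓ)) (y : X) :
    Measurable fun x => (ℓ y x : ℝ≥0∞) * α x * lam x :=
  (measurable_observationDensity hα hlam hℓ).comp measurable_prodMk_left

theorem measurable_vanishedIntensity (hα : Measurable α) (hlam : Measurable lam) :
    Measurable fun x => (1 - (α x : ℝ≥0∞)) * lam x :=
  (measurable_const.sub hα.coe_nnreal_ennreal).mul hlam.coe_nnreal_ennreal

theorem measurable_posteriorIntensity (hα : Measurable α) (hlam : Measurable lam)
    (hℓ : Measurable (Function.uncurry ℓ)) {m : ℕ} (D : Fin m → Multiset X) :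
    Measurable (posteriorIntensity ν α lam lamS ℓ D) := by
  have hsum : ∀ E : Multiset X, Measurable fun x =>
      (E.map fun y => (ℓ y x : ℝ≥0∞) * lam x / observedIntensity ν α lam lamS ℓ y).sum := by
    intro E
    induction E using Multiset.induction_on with
    | empty => simp
    | cons y E ih =>
      simp only [Multiset.map_cons, Multiset.sum_cons]
      exact (((hℓ.comp measurable_prodMk_left).coe_nnreal_ennreal.mul
        hlam.coe_nnreal_ennreal).div_const _).add ih
  exact (measurable_vanishedIntensity hα hlam).add
    ((hα.coe_nnreal_ennreal.const_mul _).mul (Finset.measurable_sum _ fun i _ => hsum (D i)))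

theorem toCountingMeasure_priorDiagram {A : Set X} (hA : MeasurableSet A)
    (H : Multiset (X × X)) (V : Multiset X) :
    toCountingMeasure (priorDiagram H V) A =
      (H.map fun z => A.indicator 1 z.1).sum + (V.map (A.indicator 1)).sum := by
  simp [toCountingMeasure_apply hA, priorDiagram]

theorem IsDiagramModel.indepFun_marked_spurious
    (hmod : IsDiagramModel P ν α lam lamS κ H V S) : IndepFun H S P :=
  hmod.indep_marked.comp (φ := id) (ψ := Prod.snd) measurable_id measurable_snd

/-- Regroups the mutual independence of H, V and S: the joint law is the triple product, and Tonelli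
exchanges the integrals over H and V. -/
theorem IsDiagramModel.indepFun_vanished
    [IsProbabilityMeasure P] (hmod : IsDiagramModel P ν α lam lamS κ H V S) :
    IndepFun V (fun ω => (H ω, S ω)) P := by
  have hH := hmod.marked.measurable
  have hV := hmod.vanished.measurable
  have hS := hmod.spurious.measurable
  have : IsProbabilityMeasure (P.map H) := Measure.isProbabilityMeasure_map hH.aemeasurable
  have : IsProbabilityMeasure (P.map V) := Measure.isProbabilityMeasure_map hV.aemeasurable
  have : IsProbabilityMeasure (P.map S) := Measure.isProbabilityMeasure_map hS.aemeasurable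
  have h1 := (indepFun_iff_map_prod_eq_prod_map_map hH.aemeasurable
    (hV.prodMk hS).aemeasurable).1 hmod.indep_marked
  have h2 := (indepFun_iff_map_prod_eq_prod_map_map hV.aemeasurable
    hS.aemeasurable).1 hmod.indep_vanished_spurious
  have h3 := (indepFun_iff_map_prod_eq_prod_map_map hH.aemeasurable
    hS.aemeasurable).1 hmod.indepFun_marked_spurious
  rw [indepFun_iff_map_prod_eq_prod_map_map hV.aemeasurable (hH.prodMk hS).aemeasurable, h3]
  refine Measure.ext_of_lintegral _ fun F hF => ?_
  have hF' : Measurable fun z : Multiset (X × X) × Multiset X × Multiset X =>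
      F (z.2.1, z.1, z.2.2) := hF.comp ((measurable_fst.comp measurable_snd).prodMk
    (measurable_fst.prodMk (measurable_snd.comp measurable_snd)))
  have hF₂ : Measurable fun z : (Multiset (X × X) × Multiset X) × Multiset X =>
      F (z.1.2, z.1.1, z.2) := hF.comp ((measurable_snd.comp measurable_fst).prodMk
    ((measurable_fst.comp measurable_fst).prodMk measurable_snd))
  calc ∫⁻ z, F z ∂P.map (fun ω => (V ω, H ω, S ω))
      = ∫⁻ z, F (z.2.1, z.1, z.2.2) ∂P.map (fun ω => (H ω, V ω, S ω)) := by
        rw [lintegral_map hF (hV.prodMk (hH.prodMk hS)),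
          lintegral_map hF' (hH.prodMk (hV.prodMk hS))]
    _ = ∫⁻ h, ∫⁻ v, ∫⁻ s, F (v, h, s) ∂P.map S ∂P.map V ∂P.map H := by
        rw [h1, h2, lintegral_prod _ hF'.aemeasurable]
        exact lintegral_congr fun h =>
          lintegral_prod _ (hF'.comp measurable_prodMk_left).aemeasurable
    _ = ∫⁻ v, ∫⁻ h, ∫⁻ s, F (v, h, s) ∂P.map S ∂P.map H ∂P.map V :=
        lintegral_lintegral_swap hF₂.lintegral_prod_right'.aemeasurable
    _ = _ := by
        rw [lintegral_prod _ hF.aemeasurable]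
        exact lintegral_congr fun v =>
          (lintegral_prod _ (hF.comp measurable_prodMk_left).aemeasurable).symm

/-- Termwise integration. The division is multiplication by a constant inverse, so the identity
holds even where the denominator is 0 or ∞. -/
theorem setLIntegral_posteriorIntensity (hα : Measurable α) (hlam : Measurable lam)
    (hℓ : Measurable (Function.uncurry ℓ)) {m : ℕ} (D : Fin m → Multiset X) (A : Set X) :
    ∫⁻ x in A, posteriorIntensity ν α lam lamS ℓ D x ∂ν =
      ∫⁻ x in A, (1 - (α x : ℝ≥0∞)) * lam x ∂ν +
        (m : ℝ≥0∞)⁻¹ * ∑ i, ((D i).map (observedShare ν α lam lamS ℓ A)).sum := by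
  have hterm : ∀ y, Measurable fun x =>
      (ℓ y x : ℝ≥0∞) * α x * lam x * (observedIntensity ν α lam lamS ℓ y)⁻¹ := fun y =>
    (measurable_observationDensity_left hα hlam hℓ y).mul_const _
  have hsum : ∀ E : Multiset X, Measurable fun x => (E.map fun y =>
      (ℓ y x : ℝ≥0∞) * α x * lam x * (observedIntensity ν α lam lamS ℓ y)⁻¹).sum := by
    intro E
    induction E using Multiset.induction_on with
    | empty => simp
    | cons y E ih =>
      simp only [Multiset.map_cons, Multiset.sum_cons]
      exact (hterm y).add ih
  have hpoint : ∀ x, posteriorIntensity ν α lam lamS ℓ D x =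
      (1 - (α x : ℝ≥0∞)) * lam x + (m : ℝ≥0∞)⁻¹ * ∑ i, ((D i).map fun y =>
        (ℓ y x : ℝ≥0∞) * α x * lam x * (observedIntensity ν α lam lamS ℓ y)⁻¹).sum := by
    intro x
    simp only [posteriorIntensity]
    rw [mul_assoc, Finset.mul_sum]
    simp only [multiset_sum_map_mul_left, div_eq_mul_inv, ← mul_assoc]
    simp only [mul_comm (α x : ℝ≥0∞)]
  simp only [hpoint]
  rw [lintegral_add_left (measurable_vanishedIntensity hα hlam), lintegral_const_mul _ (Finset.measurable_sum _ fun i _ => hsum (D i)),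
    lintegral_finsetSum _ fun i _ => hsum (D i)]
  simp only [lintegral_multiset_sum_map _ _ hterm]
  congr 2
  refine Finset.sum_congr rfl fun i _ => congrArg _ (Multiset.map_congr rfl fun y _ => ?_)
  rw [observedShare, div_eq_mul_inv, lintegral_mul_const _
    (measurable_observationDensity_left hα hlam hℓ y)]

/-- Adding a point to V leaves Y unchanged, so the Mecke formula factorises. -/
theorem IsDiagramModel.lintegral_vanished_sum_mul [IsProbabilityMeasure P]
    (hmod : IsDiagramModel P ν α lam lamS κ H V S)
    (hα : Measurable α) (hlam : Measurable lam)
    {h : X → ℝ≥0∞} (hh : Measurable h) {g : Multiset X → ℝ≥0∞} (hg : Measurable g) :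
    ∫⁻ ω, ((V ω).map h).sum * g (observedDiagram (H ω) (S ω)) ∂P =
      (∫⁻ x, (1 - (α x : ℝ≥0∞)) * lam x * h x ∂ν) *
        ∫⁻ ω, g (observedDiagram (H ω) (S ω)) ∂P := by
  have := hmod.vanished.lintegral_sum_mul
    (hmod.marked.measurable.prodMk hmod.spurious.measurable) hmod.indepFun_vanished hh
    (g := fun z => g (observedDiagram z.2.1 z.2.2))
    (hg.comp (measurable_observedDiagram.comp measurable_snd))
  refine this.trans ?_
  dsimp only
  rw [lintegral_mul_const _ hh, lintegral_withDensity_eq_lintegral_mul _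
    (measurable_vanishedIntensity hα hlam) hh]
  rfl

variable [SFinite ν]

theorem measurable_observedIntensity (hα : Measurable α) (hlam : Measurable lam)
    (hlamS : Measurable lamS) (hℓ : Measurable (Function.uncurry ℓ)) :
    Measurable (observedIntensity ν α lam lamS ℓ) :=
  hlamS.coe_nnreal_ennreal.add
    (measurable_observationDensity hα hlam hℓ).lintegral_prod_right'

theorem measurable_observedShare (hα : Measurable α) (hlam : Measurable lam)
    (hlamS : Measurable lamS) (hℓ : Measurable (Function.uncurry ℓ)) (A : Set X) :
    Measurable (observedShare ν α lam lamS ℓ A) :=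
  (measurable_observationDensity hα hlam hℓ).lintegral_prod_right'.div
    (measurable_observedIntensity hα hlam hlamS hℓ)

variable [IsProbabilityMeasure P] [IsMarkovKernel κ]

/-- The order of integration is reversed so that the mark y is the outer variable, as g sees only y.
-/
theorem lintegral_observation_compProd (hα : Measurable α) (hlam : Measurable lam)
    (hℓ : Measurable (Function.uncurry ℓ))
    (hκ : ∀ x, κ x = ν.withDensity fun y => (ℓ y x : ℝ≥0∞)) {F : X × X → ℝ≥0∞}
    (hF : Measurable F) :
    ∫⁻ z, F z ∂((ν.withDensity fun x => (α x : ℝ≥0∞) * lam x) ⊗ₘ κ) =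
      ∫⁻ y, ∫⁻ x, (ℓ y x : ℝ≥0∞) * α x * lam x * F (x, y) ∂ν ∂ν := by
  have hαl : Measurable fun x => (α x : ℝ≥0∞) * lam x :=
    hα.coe_nnreal_ennreal.mul hlam.coe_nnreal_ennreal
  have hjoint : Measurable fun z : X × X =>
      (ℓ z.1 z.2 : ℝ≥0∞) * α z.2 * lam z.2 * F (z.2, z.1) :=
    (measurable_observationDensity hα hlam hℓ).mul (hF.comp measurable_swap)
  rw [Measure.lintegral_compProd hF,
    lintegral_withDensity_eq_lintegral_mul _ hαl hF.lintegral_kernel_prod_right',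
    lintegral_lintegral_swap hjoint.aemeasurable]
  refine lintegral_congr fun x => ?_
  have hℓx : Measurable fun y => (ℓ y x : ℝ≥0∞) :=
    (hℓ.comp measurable_prodMk_right).coe_nnreal_ennreal
  have hFx : Measurable fun y => F (x, y) := hF.comp measurable_prodMk_left
  rw [Pi.mul_apply, hκ, lintegral_withDensity_eq_lintegral_mul _ hℓx hFx,
    ← lintegral_const_mul _ (hℓx.mul hFx)]
  refine lintegral_congr fun y => ?_
  simp only [Pi.mul_apply]
  ring

theorem measurable_lintegral_cons_observedDiagram (hH : Measurable H) (hS : Measurable S)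
    {g : Multiset X → ℝ≥0∞} (hg : Measurable g) :
    Measurable fun y => ∫⁻ ω, g (y ::ₘ observedDiagram (H ω) (S ω)) ∂P := by
  have : Measurable fun z : X × Ω => g (z.1 ::ₘ observedDiagram (H z.2) (S z.2)) :=
    hg.comp (measurable_fst.multiset_cons (measurable_observedDiagram.comp
      ((hH.comp measurable_snd).prodMk (hS.comp measurable_snd))))
  exact this.lintegral_prod_right'

theorem IsDiagramModel.lintegral_marked_sum_mul (hmod : IsDiagramModel P ν α lam lamS κ H V S)
    (hα : Measurable α) (hlam : Measurable lam) (hℓ : Measurable (Function.uncurry ℓ))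
    (hκ : ∀ x, κ x = ν.withDensity fun y => (ℓ y x : ℝ≥0∞))
    {h : X × X → ℝ≥0∞} (hh : Measurable h) {g : Multiset X → ℝ≥0∞} (hg : Measurable g) :
    ∫⁻ ω, ((H ω).map h).sum * g (observedDiagram (H ω) (S ω)) ∂P =
      ∫⁻ y, (∫⁻ x, (ℓ y x : ℝ≥0∞) * α x * lam x * h (x, y) ∂ν) *
        ∫⁻ ω, g (y ::ₘ observedDiagram (H ω) (S ω)) ∂P ∂ν := by
  have hH := hmod.marked.measurable
  have hS := hmod.spurious.measurable
  have hq := measurable_lintegral_cons_observedDiagram (P := P) hH hS hg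
  rw [hmod.marked.isPoissonProcess.lintegral_sum_mul hS hmod.indepFun_marked_spurious hh
    (g := fun z => g (observedDiagram z.1 z.2)) (hg.comp measurable_observedDiagram)]
  simp only [observedDiagram_cons_left]
  rw [lintegral_observation_compProd (F := fun z => h z *
    ∫⁻ ω, g (z.2 ::ₘ observedDiagram (H ω) (S ω)) ∂P) hα hlam hℓ hκ
    (hh.mul (hq.comp measurable_snd))]
  refine lintegral_congr fun y => ?_
  simp only [← mul_assoc]
  exact lintegral_mul_const _ ((measurable_observationDensity_left hα hlam hℓ y).mul (hh.comp measurable_prodMk_right))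

/-- A Mecke formula for Y with intensity λ_Y: marks contribute ∫ ℓ(y|u) α(u) λ(u) du, spurious
points contribute λ_{Y_S}(y), and both multiply the same expectation of g(Y + δ_y). -/
theorem IsDiagramModel.lintegral_observed_sum_mul (hmod : IsDiagramModel P ν α lam lamS κ H V S)
    (hα : Measurable α) (hlam : Measurable lam) (hlamS : Measurable lamS)
    (hℓ : Measurable (Function.uncurry ℓ))
    (hκ : ∀ x, κ x = ν.withDensity fun y => (ℓ y x : ℝ≥0∞))
    {h : X → ℝ≥0∞} (hh : Measurable h) {g : Multiset X → ℝ≥0∞} (hg : Measurable g) :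
    ∫⁻ ω, ((observedDiagram (H ω) (S ω)).map h).sum * g (observedDiagram (H ω) (S ω)) ∂P =
      ∫⁻ y, observedIntensity ν α lam lamS ℓ y * h y *
        ∫⁻ ω, g (y ::ₘ observedDiagram (H ω) (S ω)) ∂P ∂ν := by
  have hH := hmod.marked.measurable
  have hS := hmod.spurious.measurable
  have hq := measurable_lintegral_cons_observedDiagram (P := P) hH hS hg
  have hY : Measurable fun ω => observedDiagram (H ω) (S ω) :=
    measurable_observedDiagram.comp (hH.prodMk hS)
  have hsplit : ∀ ω, ((observedDiagram (H ω) (S ω)).map h).sum *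
      g (observedDiagram (H ω) (S ω)) =
      ((H ω).map fun z => h z.2).sum * g (observedDiagram (H ω) (S ω)) +
        ((S ω).map h).sum * g (observedDiagram (H ω) (S ω)) := by
    intro ω
    rw [← add_mul]
    congr 1
    simp [observedDiagram]
  have hm : Measurable fun ω => ((S ω).map h).sum * g (observedDiagram (H ω) (S ω)) :=
    ((measurable_multiset_sum_map hh).comp hS).mul (hg.comp hY)
  have hspur := hmod.spurious.lintegral_sum_mul hH hmod.indepFun_marked_spurious.symm hh
    (g := fun z => g (observedDiagram z.2 z.1))
    (hg.comp (measurable_observedDiagram.comp measurable_swap))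
  simp only [observedDiagram_cons_right] at hspur
  have hhq : Measurable fun y => h y * ∫⁻ ω, g (y ::ₘ observedDiagram (H ω) (S ω)) ∂P :=
    hh.mul hq
  rw [lintegral_withDensity_eq_lintegral_mul _ hlamS.coe_nnreal_ennreal hhq] at hspur
  simp only [hsplit]
  rw [lintegral_add_right _ hm, hspur,
    hmod.lintegral_marked_sum_mul hα hlam hℓ hκ (h := fun z => h z.2) (hh.comp measurable_snd) hg,
    ← lintegral_add_right _ (hlamS.coe_nnreal_ennreal.mul hhq)]
  refine lintegral_congr fun y => ?_
  simp only [Pi.mul_apply]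
  rw [lintegral_mul_const _ (measurable_observationDensity_left hα hlam hℓ y), observedIntensity]
  ring

theorem lintegral_observedIntensity_ne_top (hα : Measurable α) (hα_le : ∀ x, α x ≤ 1)
    (hlam : Measurable lam) (hlam_fin : ∫⁻ x, (lam x : ℝ≥0∞) ∂ν ≠ ∞)
    (hlamS : Measurable lamS) (hlamS_fin : ∫⁻ y, (lamS y : ℝ≥0∞) ∂ν ≠ ∞)
    (hℓ : Measurable (Function.uncurry ℓ))
    (hκ : ∀ x, κ x = ν.withDensity fun y => (ℓ y x : ℝ≥0∞)) :
    ∫⁻ y, observedIntensity ν α lam lamS ℓ y ∂ν ≠ ∞ := by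
  have := lintegral_observation_compProd (F := 1) hα hlam hℓ hκ measurable_one
  simp only [Pi.one_apply, mul_one, lintegral_one, Measure.compProd_apply_univ,
    withDensity_apply _ MeasurableSet.univ, Measure.restrict_univ] at this
  simp only [observedIntensity]
  rw [lintegral_add_left hlamS.coe_nnreal_ennreal, ← this]
  refine ENNReal.add_ne_top.2 ⟨hlamS_fin, ne_top_of_le_ne_top hlam_fin ?_⟩
  exact lintegral_mono fun x => mul_le_of_le_one_left' (ENNReal.coe_le_one_iff.2 (hα_le x))

/-- The mean number of observed points where λ_Y is 0 or ∞ is the integral of λ_Y over that set. It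
is zero: the integrand vanishes where λ_Y = 0, and λ_Y = ∞ only on a null set. -/
theorem IsDiagramModel.ae_observedIntensity_pos_lt_top
    (hmod : IsDiagramModel P ν α lam lamS κ H V S)
    (hα : Measurable α) (hlam : Measurable lam) (hlamS : Measurable lamS)
    (hℓ : Measurable (Function.uncurry ℓ))
    (hκ : ∀ x, κ x = ν.withDensity fun y => (ℓ y x : ℝ≥0∞))
    (hfin : ∫⁻ y, observedIntensity ν α lam lamS ℓ y ∂ν ≠ ∞) :
    ∀ᵐ ω ∂P, ∀ y ∈ observedDiagram (H ω) (S ω), 0 < observedIntensity ν α lam lamS ℓ y ∧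
      observedIntensity ν α lam lamS ℓ y < ∞ := by
  have hI := measurable_observedIntensity (ν := ν) hα hlam hlamS hℓ
  let bad : Set X := observedIntensity ν α lam lamS ℓ ⁻¹' {0, ∞}
  have hbad : MeasurableSet bad := hI (Set.toFinite _).measurableSet
  have hY : Measurable fun ω => observedDiagram (H ω) (S ω) :=
    measurable_observedDiagram.comp (hmod.marked.measurable.prodMk hmod.spurious.measurable)
  have hone : Measurable (bad.indicator (1 : X → ℝ≥0∞)) := measurable_one.indicator hbad
  have h0 := hmod.lintegral_observed_sum_mul hα hlam hlamS hℓ hκ hone (g := 1) measurable_one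
  have hright : ∫⁻ y, observedIntensity ν α lam lamS ℓ y * bad.indicator 1 y ∂ν = 0 := by
    rw [lintegral_eq_zero_iff (f := fun y => observedIntensity ν α lam lamS ℓ y *
      bad.indicator 1 y) (hI.mul hone)]
    filter_upwards [ae_lt_top hI hfin] with y hy
    by_cases hyb : y ∈ bad
    · have : observedIntensity ν α lam lamS ℓ y = 0 := hyb.resolve_right hy.ne
      simp [this]
    · simp [hyb]
  simp only [Pi.one_apply, mul_one, lintegral_one, measure_univ, hright] at h0
  rw [lintegral_eq_zero_iff (f := fun ω => ((observedDiagram (H ω) (S ω)).map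
    (bad.indicator 1)).sum) ((measurable_multiset_sum_map hone).comp hY)] at h0
  filter_upwards [h0] with ω hω y hy
  have hyb : y ∉ bad := by
    intro hyb
    have := Multiset.single_le_sum (fun _ _ => zero_le) _
      (Multiset.mem_map_of_mem (bad.indicator (1 : X → ℝ≥0∞)) hy)
    simp only [Pi.zero_apply] at hω
    rw [hω, Set.indicator_of_mem hyb] at this
    simp at this
  simp only [bad, Set.mem_preimage, Set.mem_insert_iff, Set.mem_singleton_iff, not_or] at hyb
  exact ⟨pos_iff_ne_zero.2 hyb.1, lt_top_iff_ne_top.2 hyb.2⟩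

/-- The Bayes step for one copy. After the Mecke formulas both sides are integrals against E[g(Y +
δ_y)], and the denominator of `observedShare` cancels λ_Y. -/
theorem IsDiagramModel.lintegral_prior_mul (hmod : IsDiagramModel P ν α lam lamS κ H V S)
    (hα : Measurable α) (hlam : Measurable lam) (hlamS : Measurable lamS)
    (hℓ : Measurable (Function.uncurry ℓ))
    (hκ : ∀ x, κ x = ν.withDensity fun y => (ℓ y x : ℝ≥0∞))
    (hfin : ∫⁻ y, observedIntensity ν α lam lamS ℓ y ∂ν ≠ ∞)
    {A : Set X} (hA : MeasurableSet A) {g : Multiset X → ℝ≥0∞} (hg : Measurable g) :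
    ∫⁻ ω, toCountingMeasure (priorDiagram (H ω) (V ω)) A *
        g (observedDiagram (H ω) (S ω)) ∂P =
      ∫⁻ ω, (∫⁻ x in A, (1 - (α x : ℝ≥0∞)) * lam x ∂ν +
        ((observedDiagram (H ω) (S ω)).map (observedShare ν α lam lamS ℓ A)).sum) *
          g (observedDiagram (H ω) (S ω)) ∂P := by
  have hV := hmod.vanished.measurable
  have hI := measurable_observedIntensity (ν := ν) hα hlam hlamS hℓ
  have hone : Measurable (A.indicator (1 : X → ℝ≥0∞)) := measurable_one.indicator hA
  have hgY : Measurable fun ω => g (observedDiagram (H ω) (S ω)) :=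
    hg.comp (measurable_observedDiagram.comp
      (hmod.marked.measurable.prodMk hmod.spurious.measurable))
  simp only [toCountingMeasure_priorDiagram hA, add_mul]
  have hm : Measurable fun ω => ((V ω).map (A.indicator 1)).sum *
      g (observedDiagram (H ω) (S ω)) :=
    ((measurable_multiset_sum_map hone).comp hV).mul hgY
  rw [lintegral_add_right _ hm, lintegral_add_left (hgY.const_mul _),
    lintegral_const_mul _ hgY, hmod.lintegral_vanished_sum_mul hα hlam hone hg, add_comm,
    hmod.lintegral_marked_sum_mul hα hlam hℓ hκ
      (h := fun z => A.indicator 1 z.1) (hone.comp measurable_fst) hg,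
    hmod.lintegral_observed_sum_mul hα hlam hlamS hℓ hκ
      (measurable_observedShare hα hlam hlamS hℓ A) hg]
  have hmulind : ∀ F : X → ℝ≥0∞, ∫⁻ x, F x * A.indicator 1 x ∂ν = ∫⁻ x in A, F x ∂ν := by
    intro F
    rw [← lintegral_indicator hA]
    refine lintegral_congr fun x => ?_
    by_cases hx : x ∈ A <;> simp [hx]
  simp only [hmulind]
  congr 1
  refine lintegral_congr_ae ?_
  filter_upwards [ae_lt_top hI hfin] with y hy
  congr 1
  rw [observedShare]
  rcases eq_or_ne (observedIntensity ν α lam lamS ℓ y) 0 with h0 | h0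
  -- Where λ_Y(y) = 0 there is nothing to cancel, but the numerator is at most λ_Y(y), so both sides
  -- are zero.
  · have : ∫⁻ x in A, (ℓ y x : ℝ≥0∞) * α x * lam x ∂ν = 0 :=
      le_antisymm ((setLIntegral_le_lintegral A _).trans (le_add_self.trans h0.le)) zero_le
    simp [this]
  · rw [ENNReal.mul_div_cancel h0 hy.ne]

/-- The mean number of observed features is at most ∫ λ_Y, that of vanished ones at most ∫ λ. -/
theorem IsDiagramModel.lintegral_prior_ne_top (hmod : IsDiagramModel P ν α lam lamS κ H V S)
    (hα : Measurable α) (hlam : Measurable lam)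
    (hlam_fin : ∫⁻ x, (lam x : ℝ≥0∞) ∂ν ≠ ∞)
    (hℓ : Measurable (Function.uncurry ℓ))
    (hκ : ∀ x, κ x = ν.withDensity fun y => (ℓ y x : ℝ≥0∞))
    (hfin : ∫⁻ y, observedIntensity ν α lam lamS ℓ y ∂ν ≠ ∞) :
    ∫⁻ ω, toCountingMeasure (priorDiagram (H ω) (V ω)) Set.univ ∂P ≠ ∞ := by
  have hV := hmod.vanished.measurable
  have h1 := hmod.lintegral_marked_sum_mul hα hlam hℓ hκ (h := 1) measurable_one (g := 1)
    measurable_one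
  have h2 := hmod.lintegral_vanished_sum_mul hα hlam (h := 1) measurable_one (g := 1)
    measurable_one
  simp only [Pi.one_apply, mul_one, lintegral_one, measure_univ] at h1 h2
  have hm : Measurable fun ω => ((V ω).map fun _ => (1 : ℝ≥0∞)).sum :=
    (measurable_multiset_sum_map measurable_one).comp hV
  simp only [toCountingMeasure_priorDiagram MeasurableSet.univ, Set.indicator_univ, Pi.one_apply]
  rw [lintegral_add_right _ hm]
  refine ENNReal.add_ne_top.2 ⟨?_, ?_⟩
  · refine ne_top_of_le_ne_top hfin ?_
    exact h1.le.trans (lintegral_mono fun y => le_add_self)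
  · refine ne_top_of_le_ne_top hlam_fin ?_
    exact h2.le.trans (lintegral_mono fun x => mul_le_of_le_one_left' tsub_le_self)

end DiagramModel

/-! ### The wedge and the posterior intensity for m realisations -/

section Posterior

/-- Needed for Tonelli. Since the wedge is measurable, its volume pushes forward to a restriction of
planar Lebesgue measure, and σ-finiteness of the image passes back. -/
instance : SFinite wedgeVolume := by
  have hW : MeasurableSet tiltedWedge := by
    have : tiltedWedge = {q : ℝ × ℝ | 0 ≤ q.1} ∩ {q | 0 ≤ q.2} := by
      ext q
      exact mem_tiltedWedge q
    rw [this]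
    exact (measurableSet_le measurable_const measurable_fst).inter
      (measurableSet_le measurable_const measurable_snd)
  have : SigmaFinite (wedgeVolume.map Subtype.val) := by
    rw [wedgeVolume, map_comap_subtype_coe hW]
    infer_instance
  have : SigmaFinite wedgeVolume := SigmaFinite.of_map _ measurable_subtype_coe.aemeasurable this
  infer_instance

end Posterior

theorem theorem3p1
    {Ω : Type*} [MeasurableSpace Ω] (P : Measure Ω) [IsProbabilityMeasure P]
    -- the observation probability, the prior intensity and the spurious intensity
    (α lam lamS : Wedge → ℝ≥0)
    (hα : Measurable α) (hα_le : ∀ x, α x ≤ 1)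
    (hlam : Measurable lam) (hlam_fin : ∫⁻ x, (lam x : ℝ≥0∞) ∂wedgeVolume ≠ ∞)
    (hlamS : Measurable lamS) (hlamS_fin : ∫⁻ y, (lamS y : ℝ≥0∞) ∂wedgeVolume ≠ ∞)
    -- the stochastic kernel and its density, with ℓ y x standing for ℓ(y|x)
    (κ : Kernel Wedge Wedge) [IsMarkovKernel κ]
    (ℓ : Wedge → Wedge → ℝ≥0) (hℓ : Measurable (Function.uncurry ℓ))
    (hκ : ∀ x, κ x = wedgeVolume.withDensity fun y => (ℓ y x : ℝ≥0∞))
    -- m independent realisations of the model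
    {m : ℕ} (hm : 0 < m)
    (H : Fin m → Ω → Multiset (Wedge × Wedge)) (V S : Fin m → Ω → Multiset Wedge)
    (hmodel : ∀ i, IsDiagramModel P wedgeVolume α lam lamS κ (H i) (V i) (S i))
    (hindep : iIndepFun (fun i ω => (H i ω, V i ω, S i ω)) P)
    -- the underlying and the observed diagrams
    (DX DY : Fin m → Ω → Multiset Wedge)
    (hDX : ∀ i ω, DX i ω = priorDiagram (H i ω) (V i ω))
    (hDY : ∀ i ω, DY i ω = observedDiagram (H i ω) (S i ω)) :
    -- the denominators of the formula are positive and finite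
    (∀ᵐ ω ∂P, ∀ i, ∀ y ∈ DY i ω,
      0 < observedIntensity wedgeVolume α lam lamS ℓ y ∧
        observedIntensity wedgeVolume α lam lamS ℓ y < ∞) ∧
    -- the posterior intensity given all the observed diagrams
    IsConditionalIntensity P (observationAlgebra DY) wedgeVolume
      (fun ω => pooledMeasure fun i => DX i ω)
      (fun ω => posteriorIntensity wedgeVolume α lam lamS ℓ fun i => DY i ω) ∧
    -- the contribution of each single realisation
    (∀ i, IsConditionalIntensity P (observationAlgebra DY) wedgeVolume
      (fun ω => toCountingMeasure (DX i ω))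
      (fun ω => posteriorIntensity wedgeVolume α lam lamS ℓ fun _ : Fin 1 => DY i ω)) := by
  have hI := lintegral_observedIntensity_ne_top hα hα_le hlam hlam_fin hlamS hlamS_fin hℓ hκ
  let priorMass (A : Set Wedge) (z : Multiset (Wedge × Wedge) × Multiset Wedge × Multiset Wedge) :
      ℝ≥0∞ := toCountingMeasure (priorDiagram z.1 z.2.1) A
  let posteriorMass (A : Set Wedge) (D : Multiset Wedge) : ℝ≥0∞ :=
    ∫⁻ x in A, (1 - (α x : ℝ≥0∞)) * lam x ∂wedgeVolume +
      (D.map (observedShare wedgeVolume α lam lamS ℓ A)).sum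
  let observe (z : Multiset (Wedge × Wedge) × Multiset Wedge × Multiset Wedge) :
      Multiset Wedge := observedDiagram z.1 z.2.2
  have hobs : Measurable observe := measurable_observedDiagram.comp
    (measurable_fst.prodMk (measurable_snd.comp measurable_snd))
  have hprior : ∀ A, MeasurableSet A → Measurable (priorMass A) := fun A hA =>
    (Measure.measurable_coe hA).comp (measurable_toCountingMeasure.comp
      (measurable_priorDiagram.comp (measurable_fst.prodMk (measurable_fst.comp measurable_snd))))
  have hpost : ∀ A, Measurable (posteriorMass A) := fun A =>
    (measurable_multiset_sum_map (measurable_observedShare hα hlam hlamS hℓ A)).const_add _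
  have hZ : ∀ i, Measurable fun ω => (H i ω, V i ω, S i ω) := fun i =>
    (hmodel i).marked.measurable.prodMk
      ((hmodel i).vanished.measurable.prodMk (hmodel i).spurious.measurable)
  have hDY' : DY = fun i ω => observe (H i ω, V i ω, S i ω) := by
    ext1 i; ext1 ω; exact hDY i ω
  have hDXA : ∀ A i ω, toCountingMeasure (DX i ω) A = priorMass A (H i ω, V i ω, S i ω) :=
    fun A i ω => by rw [hDX]
  have h𝒢 : observationAlgebra DY ≤ ‹MeasurableSpace Ω› := by
    rw [hDY']
    exact iSup_le fun i => (hobs.comp (hZ i)).comap_le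
  have hDY𝒢 : ∀ i, Measurable[observationAlgebra DY] (DY i) := fun i =>
    measurable_iff_comap_le.2 (le_iSup (fun i => MeasurableSpace.comap (DY i) _) i)
  have hXm : ∀ A, MeasurableSet A → ∀ i, Measurable fun ω => toCountingMeasure (DX i ω) A := by
    intro A hA i
    simp only [hDXA]
    exact (hprior A hA).comp (hZ i)
  have hfin : ∀ i A, ∫⁻ ω, toCountingMeasure (DX i ω) A ∂P ≠ ∞ := by
    intro i A
    simp only [hDX]
    exact ne_top_of_le_ne_top
      ((hmodel i).lintegral_prior_ne_top hα hlam hlam_fin hℓ hκ hI)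
      (lintegral_mono fun ω => measure_mono (Set.subset_univ A))
  have hsingle : ∀ A, MeasurableSet A → ∀ i C, MeasurableSet[observationAlgebra DY] C →
      ∫⁻ ω in C, toCountingMeasure (DX i ω) A ∂P = ∫⁻ ω in C, posteriorMass A (DY i ω) ∂P := by
    intro A hA i C hC
    -- The single-copy identity, with g the indicator of B, supplies the hypothesis on events
    -- determined by Y^i alone.
    have := setLIntegral_eq_of_iIndepFun hZ hindep hobs i (hprior A hA)
      ((hpost A).comp hobs) (by simpa only [hDXA] using hfin i A)
      (fun B hB => (hmodel i).lintegral_prior_mul hα hlam hlamS hℓ hκ hI hA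
        (measurable_one.indicator hB)) (by rw [hDY']) hC
    simpa only [hDXA, hDY', Function.comp_apply] using this
  have hdens : ∀ A {k : ℕ} (D : Fin k → Multiset Wedge), k ≠ 0 →
      ∫⁻ x in A, posteriorIntensity wedgeVolume α lam lamS ℓ D x ∂wedgeVolume =
        (k : ℝ≥0∞)⁻¹ * ∑ j, posteriorMass A (D j) := by
    intro A k D hk
    rw [setLIntegral_posteriorIntensity hα hlam hℓ]
    simp only [posteriorMass, Finset.sum_add_distrib, Finset.sum_const, Finset.card_univ,
      Fintype.card_fin, nsmul_eq_mul, mul_add, ← mul_assoc]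
    -- Each `posteriorMass` contains a vanished term; averaging k equal copies returns the single
    -- one in `posteriorIntensity`, which requires k ≠ 0.
    rw [ENNReal.inv_mul_cancel (by exact_mod_cast hk) (ENNReal.natCast_ne_top k), one_mul]
  have hdens1 : ∀ A (D : Multiset Wedge), ∫⁻ x in A, posteriorIntensity wedgeVolume α lam lamS ℓ
      (fun _ : Fin 1 => D) x ∂wedgeVolume = posteriorMass A D := by
    intro A D
    simp [hdens A (fun _ : Fin 1 => D) one_ne_zero]
  have hpost𝒢 : ∀ A i, Measurable[observationAlgebra DY] fun ω => posteriorMass A (DY i ω) :=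
    fun A i => (hpost A).comp (hDY𝒢 i)
  refine ⟨?_, ?_, fun i => ?_⟩
  · rw [ae_all_iff]
    intro i
    simp only [hDY]
    exact (hmodel i).ae_observedIntensity_pos_lt_top hα hlam hlamS hℓ hκ hI
  · have hpool : ∀ A ω, pooledMeasure (fun i => DX i ω) A =
        (m : ℝ≥0∞)⁻¹ * ∑ i, toCountingMeasure (DX i ω) A := by
      intro A ω
      simp [pooledMeasure, toCountingMeasure_sum]
    have hm0 : (m : ℝ≥0∞)⁻¹ ≠ ∞ := by simpa using hm.ne'
    refine isConditionalIntensity_of_setLIntegral_eq h𝒢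
      (fun ω => measurable_posteriorIntensity hα hlam hℓ _) (fun A hA => ?_) (fun A hA => ?_) ?_
      fun A hA C hC => ?_
    · simp only [hpool]
      exact (Finset.measurable_sum _ fun i _ => hXm A hA i).const_mul _
    · simp only [hdens _ _ hm.ne']
      exact (Finset.measurable_sum _ fun i _ => hpost𝒢 A i).const_mul _
    · simp only [hpool]
      rw [lintegral_const_mul _ (Finset.measurable_sum _ fun i _ => hXm _ MeasurableSet.univ i),
        lintegral_finsetSum _ fun i _ => hXm _ MeasurableSet.univ i]
      exact ENNReal.mul_ne_top hm0 (ENNReal.sum_ne_top.2 fun i _ => hfin i _)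
    · have hpostm : ∀ i, Measurable fun ω => posteriorMass A (DY i ω) := fun i =>
        (hpost𝒢 A i).mono h𝒢 le_rfl
      simp only [hpool, hdens _ _ hm.ne']
      rw [lintegral_const_mul _ (Finset.measurable_sum _ fun i _ => hXm A hA i),
        lintegral_finsetSum _ fun i _ => hXm A hA i,
        lintegral_const_mul _ (Finset.measurable_sum _ fun i _ => hpostm i),
        lintegral_finsetSum _ fun i _ => hpostm i]
      simp only [hsingle A hA _ C hC]
  · refine isConditionalIntensity_of_setLIntegral_eq h𝒢
      (fun ω => measurable_posteriorIntensity hα hlam hℓ _) (fun A hA => hXm A hA i)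
      (fun A hA => ?_) (hfin i _) fun A hA C hC => ?_
    · simp only [hdens1]
      exact hpost𝒢 A i
    · simp only [hdens1]
      exact hsingle A hA i C hC
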